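/- **Conventions.** For an ordinal $\xi>0$ let $\ell\xi$ be the unique $\beta$ such that $\xi=\alpha+\omega^\beta$ for some $\alpha$, and let $\ell 0=0$. A function on the ordinals is *initial* if it maps initial segments to initial segments. The *hyperlogarithms* $\langle\ell^\xi\rangle_{\xi\in\mathsf{On}}$ are the unique family of initial functions with (1) $\ell^1=\ell$, (2) $\ell^{\alpha+\beta}=\ell^\beta\circ\ell^\alpha$ for all $\alpha,\beta$, and (3) each $\ell^\xi$ is pointwise maximal given the previous ones: if a family $\langle g^\xi\rangle$ of initial functions satisfies (1) and (2), and $g^\eta=\ell^\eta$ for all $\eta<\xi$, then $g^\xi(x)\le\ell^\xi(x)$ for all $x$. For a topological space $\langle X,\mathcal T\rangle$, $dA$ denotes the set of limit points of $A\subseteq X$; let $d^0A=A$, $d^{\xi+1}A=d\,d^\xi A$, and $d^\lambda A=\bigcap_{\xi<\lambda}d^\xi A$ for limit $\lambda$. The space is *scattered* if every nonempty subset has an isolated point; then the *rank* $\rho(x)$ of $x\in X$ is the least $\alpha$ with $x\notin d^{\alpha+1}X$. Let $\mathcal T\subseteq\mathcal T'$ be topologies on $X$ with $\mathcal T$ scattered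 and rank functions $\rho,\rho'$. Then $\mathcal T'$ is a *rank-preserving refinement* of $\mathcal T$ if $\rho=\rho'$; it is a *limit-refinement* of $\mathcal T$ if moreover, whenever $\rho(x)$ is not a limit ordinal, every $\mathcal T'$-neighborhood of $x$ contains a $\mathcal T$-neighborhood of $x$; it is a *limit-maximal refinement* of $\mathcal T$ if it is a limit-refinement of $\mathcal T$ that is not properly contained in any limit-refinement of $\mathcal T$. Let $\Theta,\Lambda$ be ordinals. The *interval topology* on $\Theta$ is generated by the intervals $[0,\beta]$ and $(\alpha,\beta]$. The *Icard topology* $\mathcal I_0$ on $\Theta$ consists of all downward closed sets, and for $\lambda>0$, $\mathcal I_\lambda$ is generated by the sets $\{\vartheta<\Theta:\ell^\xi\vartheta\le\beta\}$ and $\{\vartheta<\Theta:\alpha<\ell^\xi\vartheta\le\beta\}$ for $\alpha<\beta\le\Theta$ (in the first form, any $\beta\le\Theta$) and $\xi<\lambda$. A family $\langle\mathcal T_\xi\rangle_{\xi<\Lambda}$ of topologies on $\Theta$ is a *$\Lambda$-BG space* (Beklemishev–Gabelaia space) if $\mathcal T_0$ is a limit-maximal refinement of the interval topology and, for all $0<\xi<\Lambda$,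 $\mathcal T_\xi$ is a limit-maximal refinement of $\mathcal T_\xi^-$, where $\mathcal T_{\zeta+1}^-$ is the topology generated by $\mathcal T_\zeta\cup\{d_\zeta S:S\subseteq\Theta\}$ ($d_\zeta$ being the derived set operator of $\mathcal T_\zeta$), and, for limit $\xi$, $\mathcal T_\xi^-$ is the topology generated by $\bigcup_{\zeta<\xi}\mathcal T_\zeta$. **Lemma.** If $\langle\mathcal T_\xi\rangle_{\xi<\Lambda}$ is a $\Lambda$-BG space on $\Theta$, then for every $\lambda<\Lambda$ the topology $\mathcal T_\lambda$ is a rank-preserving refinement of $\mathcal I_{1+\lambda}$. In particular, the rank of $\vartheta<\Theta$ with respect to $\mathcal T_\lambda$ is $\ell^{1+\lambda}\vartheta$. -/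

import Mathlib

open Ordinal
open scoped Topology

universe u

namespace GLPSpace

noncomputable section

/-! ### The function `ℓ` and its transfinite iterates, the hyperlogarithms -/

/-- Every nonzero ordinal is `α + ω ^ β` for exactly one `β`. -/
theorem existsUnique_lastExponent {ξ : Ordinal.{u}} (hξ : ξ ≠ 0) :
    ∃! β : Ordinal.{u}, ∃ α : Ordinal.{u}, ξ = α + ω ^ β := by
  have hex : ∀ ξ : Ordinal.{u}, ξ ≠ 0 → ∃ β α : Ordinal.{u}, ξ = α + ω ^ β := by
    intro ξ
    induction ξ using WellFoundedLT.induction with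
    | ind ξ ih =>
      intro h
      have hle : ω ^ log ω ξ ≤ ξ := opow_log_le_self ω h
      have hlt := sub_omega0_opow_log_lt h
      have hsum := Ordinal.add_sub_cancel_of_le hle
      by_cases h0 : ξ - ω ^ log ω ξ = 0
      · refine ⟨log ω ξ, 0, ?_⟩
        rw [h0, add_zero] at hsum
        rw [zero_add, hsum]
      · obtain ⟨β, α, hα⟩ := ih _ hlt h0
        refine ⟨β, ω ^ log ω ξ + α, ?_⟩
        rw [add_assoc, ← hα, hsum]
  have huniq : ∀ α α' β γ : Ordinal.{u}, α + ω ^ β = α' + ω ^ γ → ¬ β < γ := by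
    intro α α' β γ h hlt
    have hpow : (ω : Ordinal.{u}) ^ β < ω ^ γ := (opow_lt_opow_iff_right one_lt_omega0).2 hlt
    rcases le_total α' α with hle | hle
    · rw [← Ordinal.add_sub_cancel_of_le hle, add_assoc, add_right_inj] at h
      have hpos : (0 : Ordinal.{u}) < ω ^ β := opow_pos _ omega0_pos
      have h1 : α - α' < ω ^ γ := by
        rw [← h]
        exact lt_add_of_pos_right _ hpos
      exact absurd h (isPrincipal_add_omega0_opow γ h1 hpow).ne
    · rw [← Ordinal.add_sub_cancel_of_le hle, add_assoc, add_right_inj] at h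
      have : (ω : Ordinal.{u}) ^ γ ≤ ω ^ β := by
        rw [h]
        exact le_add_self
      exact absurd hpow this.not_gt
  obtain ⟨β, α, h⟩ := hex ξ hξ
  refine ⟨β, ⟨α, h⟩, ?_⟩
  rintro γ ⟨α', h'⟩
  rcases lt_trichotomy γ β with hlt | heq | hlt
  · exact absurd hlt (huniq α' α γ β (h'.symm.trans h))
  · exact heq
  · exact absurd hlt (huniq α α' β γ (h.symm.trans h'))

/-- `ℓ ξ` is the unique `β` with `ξ = α + ω ^ β` for some `α` if `ξ ≠ 0`, and `ℓ 0 = 0`. -/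
def ell (ξ : Ordinal.{u}) : Ordinal.{u} :=
  open Classical in if h : ξ = 0 then 0 else (existsUnique_lastExponent h).choose

/-- An initial function maps initial segments to initial segments. -/
def IsInitialFunction (f : Ordinal.{u} → Ordinal.{u}) : Prop :=
  ∀ s : Set Ordinal.{u}, IsLowerSet s → IsLowerSet (f '' s)

/-- Families of initial functions that iterate `ℓ` transfinitely: `g¹ = ℓ` and
`g^(α + β) = g^β ∘ g^α`. -/
structure IsIterationOfEll (g : Ordinal.{u} → Ordinal.{u} → Ordinal.{u}) : Prop where
  isInitial : ∀ ξ, IsInitialFunction (g ξ)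
  one : g 1 = ell
  add : ∀ α β, g (α + β) = g β ∘ g α

/-- The hyperlogarithms: the iteration of `ℓ` each of whose members is pointwise maximal, given the
preceding members. -/
structure IsHyperlogarithm (L : Ordinal.{u} → Ordinal.{u} → Ordinal.{u}) : Prop
    extends IsIterationOfEll L where
  maximal : ∀ g : Ordinal.{u} → Ordinal.{u} → Ordinal.{u}, IsIterationOfEll g →
    ∀ ξ, (∀ η < ξ, g η = L η) → ∀ x, g ξ x ≤ L ξ x

theorem ell_zero : ell (0 : Ordinal.{u}) = 0 := by
  simp [ell]

theorem ell_add_opow (α β : Ordinal.{u}) : ell (α + ω ^ β) = β := by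
  have hne : α + ω ^ β ≠ 0 := by
    have h1 : (0 : Ordinal.{u}) < ω ^ β := opow_pos _ omega0_pos
    exact (h1.trans_le le_add_self).ne'
  have hs := existsUnique_lastExponent hne
  simp only [ell, hne, dif_neg, not_false_iff]
  exact hs.unique hs.choose_spec.1 ⟨α, rfl⟩

theorem isInitialFunction_iff {f : Ordinal.{u} → Ordinal.{u}} :
    IsInitialFunction f ↔ ∀ x, ∀ z ≤ f x, ∃ y ≤ x, f y = z := by
  constructor
  · intro h x z hz
    obtain ⟨y, hy, rfl⟩ := h (Set.Iic x) (isLowerSet_Iic x) hz ⟨x, Set.self_mem_Iic, rfl⟩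
    exact ⟨y, hy, rfl⟩
  · rintro h s hs _ z hz ⟨x, hx, rfl⟩
    obtain ⟨y, hy, rfl⟩ := h x z hz
    exact ⟨y, hs hy hx, rfl⟩

theorem IsInitialFunction.comp {f g : Ordinal.{u} → Ordinal.{u}} (hf : IsInitialFunction f)
    (hg : IsInitialFunction g) : IsInitialFunction (f ∘ g) := by
  intro s hs
  rw [Set.image_comp]
  exact hf _ (hg _ hs)

theorem IsInitialFunction.le_self {f : Ordinal.{u} → Ordinal.{u}} (hf : IsInitialFunction f)
    (x : Ordinal.{u}) : f x ≤ x := by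
  induction x using WellFoundedLT.induction with
  | ind x ih =>
    by_contra! hlt
    obtain ⟨y, hy, hxy⟩ := isInitialFunction_iff.1 hf x x hlt.le
    rcases hy.lt_or_eq with h | rfl
    · exact absurd (ih y h) (by rw [hxy]; exact h.not_ge)
    · exact hlt.ne' hxy

theorem isInitialFunction_ell : IsInitialFunction (ell : Ordinal.{u} → Ordinal.{u}) := by
  rw [isInitialFunction_iff]
  intro x z hz
  by_cases h : x = 0
  · subst h
    rw [ell_zero] at hz
    have hz0 : z = 0 := le_antisymm hz zero_le
    exact ⟨0, le_rfl, by rw [ell_zero, hz0]⟩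
  · obtain ⟨β, ⟨α, rfl⟩, -⟩ := existsUnique_lastExponent h
    rw [ell_add_opow] at hz
    exact ⟨α + ω ^ z, by gcongr; exact omega0_pos, ell_add_opow α z⟩

/-- Auxiliary recursion for the existence of hyperlogarithms. -/
def limStep (v : Ordinal.{u} → Ordinal.{u}) (x : Ordinal.{u}) : Ordinal.{u} :=
  open Classical in
  if _h : v x < x then limStep v (v x) else ⨆ y : Set.Iio x, (limStep v y.1 + 1)
termination_by x
decreasing_by
  · assumption
  · exact y.2

/-- Auxiliary construction of the hyperlogarithms. -/
def hyperlogAux (ξ : Ordinal.{u}) : Ordinal.{u} → Ordinal.{u} :=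
  open Classical in
  if _h0 : ξ = 0 then id
  else if ξ = 1 then ell
  else if _h : ω ^ log ω ξ < ξ then hyperlogAux (ξ - ω ^ log ω ξ) ∘ hyperlogAux (ω ^ log ω ξ)
  else limStep fun x => ⨅ η : Set.Iio ξ, hyperlogAux η.1 x
termination_by ξ
decreasing_by
  · exact sub_omega0_opow_log_lt _h0
  · assumption
  · exact η.2

theorem limStep_apply {v : Ordinal.{u} → Ordinal.{u}} (hle : ∀ x, v x ≤ x) (x : Ordinal.{u}) : limStep v (v x) = limStep v x := by
  rcases (hle x).lt_or_eq with h | h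
  · conv_rhs => rw [limStep]
    rw [dif_pos h]
  · rw [h]

theorem limStep_of_not_lt {v : Ordinal.{u} → Ordinal.{u}} {x : Ordinal.{u}} (h : ¬ v x < x) :
    limStep v x = ⨆ y : Set.Iio x, (limStep v y.1 + 1) := by
  rw [limStep, dif_neg h]

theorem isInitialFunction_limStep (v : Ordinal.{u} → Ordinal.{u}) :
    IsInitialFunction (limStep v) := by
  rw [isInitialFunction_iff]
  intro x
  induction x using WellFoundedLT.induction with
  | ind x ih =>
    intro z hz
    rcases hz.lt_or_eq with hlt | rfl
    swap
    · exact ⟨x, le_rfl, rfl⟩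
    by_cases h : v x < x
    · rw [limStep, dif_pos h] at hz
      obtain ⟨y, hy, hyz⟩ := ih _ h z hz
      exact ⟨y, hy.trans h.le, hyz⟩
    · rw [limStep_of_not_lt h, Ordinal.lt_iSup_iff] at hlt
      obtain ⟨⟨y, hy⟩, hyz⟩ := hlt
      obtain ⟨w, hw, hwz⟩ := ih y hy z (Order.lt_add_one_iff.1 hyz)
      exact ⟨w, hw.trans (le_of_lt hy), hwz⟩

theorem hyperlogAux_zero : hyperlogAux (0 : Ordinal.{u}) = id := by
  rw [hyperlogAux, dif_pos rfl]

theorem hyperlogAux_one : hyperlogAux (1 : Ordinal.{u}) = ell := by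
  rw [hyperlogAux, dif_neg one_ne_zero, if_pos rfl]

theorem hyperlogAux_of_lt {ξ : Ordinal.{u}} (h : ω ^ log ω ξ < ξ) :
    hyperlogAux ξ = hyperlogAux (ξ - ω ^ log ω ξ) ∘ hyperlogAux (ω ^ log ω ξ) := by
  have h0 : ξ ≠ 0 := by
    rintro rfl
    exact absurd h zero_le.not_gt
  have h1 : ξ ≠ 1 := by
    rintro rfl
    simp at h
  rw [hyperlogAux, dif_neg h0, if_neg h1, dif_pos h]

theorem hyperlogAux_of_not_lt {ξ : Ordinal.{u}} (h0 : ξ ≠ 0) (h1 : ξ ≠ 1)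
    (h : ¬ ω ^ log ω ξ < ξ) :
    hyperlogAux ξ = limStep fun x => ⨅ η : Set.Iio ξ, hyperlogAux η.1 x := by
  rw [hyperlogAux, dif_neg h0, if_neg h1, dif_neg h]

theorem isInitialFunction_hyperlogAux (ξ : Ordinal.{u}) : IsInitialFunction (hyperlogAux ξ) := by
  induction ξ using WellFoundedLT.induction with
  | ind ξ ih =>
    by_cases h0 : ξ = 0
    · rw [h0, hyperlogAux_zero]
      intro s hs
      rwa [Set.image_id]
    by_cases h1 : ξ = 1
    · rw [h1, hyperlogAux_one]
      exact isInitialFunction_ell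
    by_cases h : ω ^ log ω ξ < ξ
    · rw [hyperlogAux_of_lt h]
      exact (ih _ (sub_omega0_opow_log_lt h0)).comp (ih _ h)
    · rw [hyperlogAux_of_not_lt h0 h1 h]
      exact isInitialFunction_limStep _

/-- If `h` is additive below the additively indecomposable `ξ`, then the eventual value of
`h η x` for `η < ξ` is not changed by first applying a function `h α` with `α < ξ`. -/
theorem iInf_comp {h : Ordinal.{u} → Ordinal.{u} → Ordinal.{u}} {ξ : Ordinal.{u}}
    (hle : ∀ η x, h η x ≤ x) (hP : IsPrincipal (· + ·) ξ)
    (hadd : ∀ α β, α + β < ξ → h (α + β) = h β ∘ h α) {α : Ordinal.{u}} (hα : α < ξ)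
    (x : Ordinal.{u}) :
    ⨅ η : Set.Iio ξ, h η.1 (h α x) = ⨅ η : Set.Iio ξ, h η.1 x := by
  have : Nonempty (Set.Iio ξ) := ⟨⟨α, hα⟩⟩
  apply le_antisymm
  · refine le_ciInf fun ζ => ?_
    have hlt : α + ζ.1 < ξ := hP hα ζ.2
    refine (ciInf_le' _ ζ).trans ?_
    have h1 : h ζ.1 (h α x) = h (α + ζ.1) x := by rw [hadd _ _ hlt]; rfl
    have hsum : ζ.1 + (α + ζ.1 - ζ.1) = α + ζ.1 := Ordinal.add_sub_cancel_of_le le_add_self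
    rw [h1, ← hsum, hadd _ _ (by rw [hsum]; exact hlt)]
    exact hle _ _
  · refine le_ciInf fun ζ => ?_
    have hlt : α + ζ.1 < ξ := hP hα ζ.2
    have h1 : h ζ.1 (h α x) = h (α + ζ.1) x := by rw [hadd _ _ hlt]; rfl
    rw [h1]
    exact ciInf_le' (fun η : Set.Iio ξ => h η.1 x) ⟨α + ζ.1, hlt⟩

theorem isPrincipal_of_not_lt {ξ : Ordinal.{u}} (h0 : ξ ≠ 0) (h : ¬ ω ^ log ω ξ < ξ) :
    IsPrincipal (· + ·) ξ := by
  have : ω ^ log ω ξ = ξ := le_antisymm (opow_log_le_self ω h0) (not_lt.1 h)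
  rw [← this]
  exact isPrincipal_add_omega0_opow _

theorem hyperlogAux_add (α β : Ordinal.{u}) :
    hyperlogAux (α + β) = hyperlogAux β ∘ hyperlogAux α := by
  suffices H : ∀ ξ α β : Ordinal.{u}, α + β = ξ →
      hyperlogAux (α + β) = hyperlogAux β ∘ hyperlogAux α from H _ α β rfl
  intro ξ
  induction ξ using WellFoundedLT.induction with
  | ind ξ ih =>
    intro α β hξ
    by_cases hα : α = 0
    · rw [hα, zero_add, hyperlogAux_zero, Function.comp_id]
    by_cases hβ : β = 0
    · rw [hβ, add_zero, hyperlogAux_zero, Function.id_comp]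
    have hαξ : α < ξ := by
      rw [← hξ]
      exact lt_add_of_pos_right _ (pos_iff_ne_zero.2 hβ)
    have h0 : ξ ≠ 0 := (pos_of_gt hαξ).ne'
    rw [hξ]
    by_cases h : ω ^ log ω ξ < ξ
    · have hsum := Ordinal.add_sub_cancel_of_le h.le
      have hlt := sub_omega0_opow_log_lt h0
      have hP : IsPrincipal (· + ·) (ω ^ log ω ξ) := isPrincipal_add_omega0_opow _
      have hstep := hyperlogAux_of_lt h
      generalize ω ^ log ω ξ = p at h hsum hlt hP hstep
      rw [hstep]
      rcases lt_or_ge α p with hαp | hαp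
      · have hpβ : p ≤ β := by
          by_contra! hβp
          exact absurd (hP hαp hβp) (by change ¬ α + β < p; rw [hξ]; exact h.le.not_gt)
        have hβξ : β = ξ := by
          rw [← hξ, ← Ordinal.add_sub_cancel_of_le hpβ, ← add_assoc, hP.add_eq_right hαp]
        rw [hβξ, hstep, Function.comp_assoc]
        congr 1
        have h2 := ih p h α p (hP.add_eq_right hαp)
        rwa [hP.add_eq_right hαp] at h2
      · have hα' := Ordinal.add_sub_cancel_of_le hαp
        have hsub : α - p + β = ξ - p := by
          rw [← add_right_inj (a := p), hsum, ← add_assoc, hα', hξ]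
        have h2 := ih _ hlt _ _ hsub
        have h3 := ih α hαξ _ _ hα'
        rw [hα'] at h3
        rw [← hsub, h2, h3, Function.comp_assoc]
    · have hP := isPrincipal_of_not_lt h0 h
      have hβξ : β = ξ := by
        refine le_antisymm (hξ ▸ le_add_self) (not_lt.1 fun hlt => ?_)
        exact absurd hξ (hP hαξ hlt).ne
      have h1 : ξ ≠ 1 := by
        rintro rfl
        exact hα (Order.lt_one_iff.1 hαξ)
      have hle : ∀ η x, hyperlogAux.{u} η x ≤ x := fun η =>
        (isInitialFunction_hyperlogAux η).le_self
      have hadd : ∀ α β : Ordinal.{u}, α + β < ξ →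
          hyperlogAux (α + β) = hyperlogAux β ∘ hyperlogAux α := fun a b hab => ih _ hab a b rfl
      have : Nonempty (Set.Iio ξ) := ⟨⟨α, hαξ⟩⟩
      have hvle : ∀ x, ⨅ η : Set.Iio ξ, hyperlogAux η.1 x ≤ x := fun x =>
        (ciInf_le' _ ⟨α, hαξ⟩).trans (hle α x)
      rw [hβξ, hyperlogAux_of_not_lt h0 h1 h]
      funext x
      rw [Function.comp_apply, ← limStep_apply hvle x,
        ← limStep_apply hvle (hyperlogAux α x), iInf_comp hle hP hadd hαξ x]

theorem isHyperlogarithm_hyperlogAux : IsHyperlogarithm hyperlogAux.{u} := by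
  refine ⟨⟨isInitialFunction_hyperlogAux, hyperlogAux_one, hyperlogAux_add⟩, ?_⟩
  intro g hg ξ hη
  by_cases h0 : ξ = 0
  · intro x
    rw [h0, hyperlogAux_zero]
    exact (hg.isInitial 0).le_self x
  by_cases h1 : ξ = 1
  · intro x
    rw [h1, hyperlogAux_one, hg.one]
  by_cases h : ω ^ log ω ξ < ξ
  · intro x
    have hsum := Ordinal.add_sub_cancel_of_le h.le
    have h2 : g ξ = hyperlogAux ξ := by
      rw [hyperlogAux_of_lt h, ← hη _ h, ← hη _ (sub_omega0_opow_log_lt h0), ← hg.add, hsum]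
    rw [h2]
  · have hP := isPrincipal_of_not_lt h0 h
    have : Nonempty (Set.Iio ξ) := ⟨⟨0, pos_iff_ne_zero.2 h0⟩⟩
    intro x
    induction x using WellFoundedLT.induction with
    | ind x ih =>
      rw [hyperlogAux_of_not_lt h0 h1 h] at ih ⊢
      by_cases hv : ⨅ η : Set.Iio ξ, hyperlogAux η.1 x < x
      · obtain ⟨ζ, hζ⟩ := ciInf_mem fun ζ : Set.Iio ξ => hyperlogAux ζ.1 x
        rw [limStep, dif_pos hv]
        refine le_trans (le_of_eq ?_) (ih _ hv)
        rw [← hζ]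
        have h2 := hg.add ζ.1 ξ
        rw [hP.add_eq_right ζ.2, hη ζ.1 ζ.2] at h2
        exact congrFun h2 x
      · rw [limStep_of_not_lt hv]
        by_contra! hlt
        obtain ⟨y, hy, hyx⟩ := isInitialFunction_iff.1 (hg.isInitial ξ) x _ hlt.le
        rcases hy.lt_or_eq with hyx' | rfl
        · have h3 := Ordinal.le_iSup
            (fun y : Set.Iio x => limStep (fun x => ⨅ η : Set.Iio ξ, hyperlogAux η.1 x) y.1 + 1)
            ⟨y, hyx'⟩
          rw [← hyx] at h3
          exact absurd (ih y hyx') (Order.add_one_le_iff.1 h3).not_ge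
        · exact hlt.ne' hyx

theorem existsUnique_isHyperlogarithm :
    ∃! L : Ordinal.{u} → Ordinal.{u} → Ordinal.{u}, IsHyperlogarithm L := by
  have hA := isHyperlogarithm_hyperlogAux.{u}
  refine ⟨hyperlogAux, hA, fun L hL => ?_⟩
  funext ξ
  induction ξ using WellFoundedLT.induction with
  | ind ξ ih =>
    funext x
    exact le_antisymm (hA.maximal L hL.toIsIterationOfEll ξ ih x)
      (hL.maximal _ hA.toIsIterationOfEll ξ (fun η hη => (ih η hη).symm) x)

/-- The hyperlogarithm `ℓ^ξ`. -/
def hyperlog : Ordinal.{u} → Ordinal.{u} → Ordinal.{u} :=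
  existsUnique_isHyperlogarithm.choose

/-! ### Scattered spaces, ranks and refinements

Topologies on a set are compared through their open sets; `S` refines `T` if every `T`-open set is
`S`-open. -/

section Topology

variable {X : Type u}

/-- The set of limit points of `A` with respect to the topology `T`. -/
def derived (T : TopologicalSpace X) (A : Set X) : Set X :=
  @derivedSet X T A

/-- The transfinite iterates of the derived set operator. -/
def iterDerived (T : TopologicalSpace X) (A : Set X) (ξ : Ordinal.{u}) : Set X :=
  Ordinal.limitRecOn ξ A (fun _ B => derived T B) (fun ξ _ B => ⋂ (η) (h : η < ξ), B η h)

/-- Every nonempty subset has an isolated point. -/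
def IsScattered (T : TopologicalSpace X) : Prop :=
  ∀ A : Set X, A.Nonempty → ∃ x ∈ A, ∃ U, IsOpen[T] U ∧ U ∩ A = {x}

/-- The rank of a point of a scattered space: the least `α` with `x ∉ d^(α + 1) X`. -/
def rank (T : TopologicalSpace X) (x : X) : Ordinal.{u} :=
  sInf {α | x ∉ iterDerived T Set.univ (α + 1)}

/-- `S` is a rank-preserving refinement of the scattered topology `T`. -/
structure IsRankPreservingRefinement (T S : TopologicalSpace X) : Prop where
  isScattered : IsScattered T
  isOpen_of_isOpen : ∀ U, IsOpen[T] U → IsOpen[S] U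
  rank_eq : rank T = rank S

/-- `S` is a limit-refinement of `T`. -/
structure IsLimitRefinement (T S : TopologicalSpace X) : Prop
    extends IsRankPreservingRefinement T S where
  exists_subset : ∀ x, ¬ Order.IsSuccLimit (rank T x) → ∀ U, IsOpen[S] U → x ∈ U →
    ∃ V, IsOpen[T] V ∧ x ∈ V ∧ V ⊆ U

/-- `S` is a limit-maximal refinement of `T`: a limit-refinement of `T` that is not properly
refined by any other limit-refinement of `T`. -/
structure IsLimitMaximalRefinement (T S : TopologicalSpace X) : Prop
    extends IsLimitRefinement T S where
  maximal : ∀ R, IsLimitRefinement T R → (∀ U, IsOpen[S] U → IsOpen[R] U) → R = S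

/-- The topology `T⁺` generated by the `T`-open sets and all sets of limit points. -/
@[reducible]
def plusTopology (T : TopologicalSpace X) : TopologicalSpace X :=
  TopologicalSpace.generateFrom ({U | IsOpen[T] U} ∪ Set.range (derived T))

/-- The topology generated by the topologies `T ζ` with `ζ < ξ`. -/
@[reducible]
def joinTopology (T : Ordinal.{u} → TopologicalSpace X) (ξ : Ordinal.{u}) : TopologicalSpace X :=
  TopologicalSpace.generateFrom {U | ∃ ζ < ξ, IsOpen[T ζ] U}

end Topology

/-! ### Topologies on an ordinal

The ordinal `Θ` as a set is the type `Θ.ToType`, whose elements are coerced to ordinals `< Θ`. -/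

/-- The initial segment topology, whose open sets are the downward closed sets. -/
@[reducible]
def initialSegmentTopology (Θ : Ordinal.{u}) : TopologicalSpace Θ.ToType where
  IsOpen := IsLowerSet
  isOpen_univ := isLowerSet_univ
  isOpen_inter _ _ := IsLowerSet.inter
  isOpen_sUnion _ := isLowerSet_sUnion

/-- The interval topology, generated by the intervals `[0, β]` and `(α, β]`. -/
@[reducible]
def intervalTopology (Θ : Ordinal.{u}) : TopologicalSpace Θ.ToType :=
  TopologicalSpace.generateFrom
    ({U | ∃ β, U = {x : Θ.ToType | (x : Ordinal) ≤ β}} ∪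
      {U | ∃ α β, U = {x : Θ.ToType | α < (x : Ordinal) ∧ (x : Ordinal) ≤ β}})

/-- The Icard topology `I_ξ` on `Θ`: for `ξ = 0` it is the initial segment topology, and for `ξ > 0` it is generated by the sets `[0, β]_ζ = {x | ℓ^ζ x ≤ β}` with `β ≤ Θ` and
`(α, β]_ζ = {x | α < ℓ^ζ x ≤ β}` with `α < β ≤ Θ`, for `ζ < ξ`. -/
@[reducible]
def icardTopology (Θ ξ : Ordinal.{u}) : TopologicalSpace Θ.ToType :=
  open Classical in
  if ξ = 0 then initialSegmentTopology Θ
  else TopologicalSpace.generateFrom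
    ({U | ∃ ζ < ξ, ∃ β ≤ Θ, U = {x : Θ.ToType | hyperlog ζ x ≤ β}} ∪
      {U | ∃ ζ < ξ, ∃ α β, α < β ∧ β ≤ Θ ∧
        U = {x : Θ.ToType | α < hyperlog ζ x ∧ hyperlog ζ x ≤ β}})

/-- The polytopology `⟨T ξ⟩` for `ξ < Λ` on `Θ` is a Beklemishev-Gabelaia space. The values `T ξ`
with `Λ ≤ ξ` are irrelevant. -/
structure IsBGSpace (Θ Λ : Ordinal.{u}) (T : Ordinal.{u} → TopologicalSpace Θ.ToType) : Prop where
  zero : 0 < Λ → IsLimitMaximalRefinement (intervalTopology Θ) (T 0)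
  add_one : ∀ ζ, ζ + 1 < Λ → IsLimitMaximalRefinement (plusTopology (T ζ)) (T (ζ + 1))
  limit : ∀ ξ < Λ, Order.IsSuccLimit ξ → IsLimitMaximalRefinement (joinTopology T ξ) (T ξ)

end

end GLPSpace

/-! The rank on a scattered space is the only ordinal-valued function `f` that drops strictly on a
punctured neighborhood of each point and takes, on every neighborhood of `x`, every value below `f
x` (`IsRankFunction.rank_eq`). The first property passes to finer topologies, the second to coarser
ones. So it suffices that `ℓ^(1+ξ)` drops near points of the Icard topology and is a rank function
for the finer `T ξ`; both rank claims follow.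

The induction shows that `T ξ` is a limit-maximal refinement of some `S` that refines the Icard
topology and has rank function `ℓ^(1+ξ)`. Successors rest on limit-maximality: near a limit point
`x` of `A` of limit rank, all points of rank above some `α` below the rank of `x` are limit points
of `A`, for otherwise the complement of the closure of `A`, with `x` added, would be open. Hence
every open set of the plus topology contains, near each of its points of limit rank, a tail of
ranks. Every tail of ranks below `δ + ω ^ η` contains ordinals with each last exponent below `η`, so
the new rank is `ell` of the old one (`IsLimitMaximalRefinement.isRankFunction_plusTopology`).

At limits, the drop comes from the maximality of the hyperlogarithms, through their construction by
`limStep`, and the attained values from their initiality. -/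

namespace GLPSpace

/-! ### Rank functions on scattered spaces -/

section Topology

variable {X : Type u}

theorem mem_derived {T : TopologicalSpace X} {A : Set X} {x : X} :
    x ∈ derived T A ↔ ∀ U, IsOpen[T] U → x ∈ U → ∃ y ∈ U, y ∈ A ∧ y ≠ x := by
  rw [derived, mem_derivedSet, accPt_iff_nhds]
  constructor
  · intro h U hU hx
    obtain ⟨y, ⟨hyU, hyA⟩, hyx⟩ := h U (hU.mem_nhds hx)
    exact ⟨y, hyU, hyA, hyx⟩
  · intro h N hN
    obtain ⟨U, hUN, hU, hx⟩ := mem_nhds_iff.1 hN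
    obtain ⟨y, hyU, hyA, hyx⟩ := h U hU hx
    exact ⟨y, ⟨hUN hyU, hyA⟩, hyx⟩

/-- The topology `T` is coarser than `S`, in the form used by the refinement structures. -/
theorem le_iff_forall_isOpen {T S : TopologicalSpace X} :
    S ≤ T ↔ ∀ U, IsOpen[T] U → IsOpen[S] U :=
  Iff.rfl

/-- Every point `x` has a neighborhood in which `f` is smaller than `f x` except at `x`. -/
def DecreasesNear (T : TopologicalSpace X) (f : X → Ordinal.{u}) : Prop :=
  ∀ x, ∃ U, IsOpen[T] U ∧ x ∈ U ∧ ∀ y ∈ U, y ≠ x → f y < f x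

/-- The ordinal-valued functions that are continuous, open and pointwise discrete for the
initial segment topology. -/
structure IsRankFunction (T : TopologicalSpace X) (f : X → Ordinal.{u}) : Prop where
  decreasesNear : DecreasesNear T f
  exists_eq : ∀ x U, IsOpen[T] U → x ∈ U → ∀ β < f x, ∃ y ∈ U, f y = β

theorem DecreasesNear.mono {T S : TopologicalSpace X} {f : X → Ordinal.{u}}
    (h : DecreasesNear T f) (hST : S ≤ T) : DecreasesNear S f := fun x =>
  let ⟨U, hU, hx, hlt⟩ := h x
  ⟨U, hST U hU, hx, hlt⟩

theorem IsRankFunction.of_le {T S : TopologicalSpace X} {f : X → Ordinal.{u}}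
    (h : IsRankFunction S f) (hT : DecreasesNear T f) (hST : S ≤ T) : IsRankFunction T f :=
  ⟨hT, fun x U hU => h.exists_eq x U (hST U hU)⟩

theorem DecreasesNear.isScattered {T : TopologicalSpace X} {f : X → Ordinal.{u}}
    (h : DecreasesNear T f) : IsScattered T := by
  intro A hA
  obtain ⟨x, hx, hmin⟩ := (InvImage.wf f Ordinal.lt_wf).has_min A hA
  obtain ⟨U, hU, hxU, hlt⟩ := h x
  refine ⟨x, hx, U, hU, Set.eq_singleton_iff_unique_mem.2 ⟨⟨hxU, hx⟩, ?_⟩⟩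
  rintro y ⟨hyU, hyA⟩
  by_contra hne
  exact hmin y hyA (hlt y hyU hne)

theorem iterDerived_add_one (T : TopologicalSpace X) (A : Set X) (ξ : Ordinal.{u}) :
    iterDerived T A (ξ + 1) = derived T (iterDerived T A ξ) :=
  Ordinal.limitRecOn_add_one ..

/-- Descent alone suffices: a limit point of an iterated derived set has in it a nearby point with
smaller `f`, so the bound rises by one. -/
theorem mem_iterDerived_univ_le {T : TopologicalSpace X} {f : X → Ordinal.{u}}
    (h : DecreasesNear T f) (α : Ordinal.{u}) :
    ∀ x ∈ iterDerived T Set.univ α, α ≤ f x := by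
  induction α using Ordinal.limitRecOn with
  | zero => exact fun _ _ => zero_le
  | add_one α ih =>
    intro x hx
    rw [iterDerived_add_one, mem_derived] at hx
    obtain ⟨U, hU, hxU, hlt⟩ := h x
    obtain ⟨y, hyU, hy, hyx⟩ := hx U hU hxU
    exact Order.add_one_le_iff.2 ((ih y hy).trans_lt (hlt y hyU hyx))
  | limit α hα ih =>
    intro x hx
    rw [iterDerived, Ordinal.limitRecOn_limit _ _ _ _ hα, Set.mem_iInter₂] at hx
    exact hα.le_iff_forall_le.2 fun β hβ => ih β hβ x (hx β hβ)

theorem IsRankFunction.mem_derived_iff {T : TopologicalSpace X} {f : X → Ordinal.{u}}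
    (h : IsRankFunction T f) (α : Ordinal.{u}) (x : X) :
    x ∈ derived T {y | α ≤ f y} ↔ α < f x := by
  rw [mem_derived]
  constructor
  · intro hx
    obtain ⟨U, hU, hxU, hlt⟩ := h.decreasesNear x
    obtain ⟨y, hyU, hy, hyx⟩ := hx U hU hxU
    exact lt_of_le_of_lt hy (hlt y hyU hyx)
  · intro hx U hU hxU
    obtain ⟨y, hyU, rfl⟩ := h.exists_eq x U hU hxU α hx
    exact ⟨y, hyU, le_refl (f y), fun e => hx.ne (congrArg f e)⟩

theorem IsRankFunction.iterDerived_univ {T : TopologicalSpace X} {f : X → Ordinal.{u}}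
    (h : IsRankFunction T f) (α : Ordinal.{u}) :
    iterDerived T Set.univ α = {x | α ≤ f x} := by
  induction α using Ordinal.limitRecOn with
  | zero => simp [iterDerived]
  | add_one α ih =>
    ext x
    rw [iterDerived_add_one, ih, h.mem_derived_iff, Set.mem_ofPred_eq, Order.add_one_le_iff]
  | limit α hα ih =>
    ext x
    rw [iterDerived, Ordinal.limitRecOn_limit _ _ _ _ hα, Set.mem_iInter₂, Set.mem_ofPred_eq,
      hα.le_iff_forall_le]
    refine forall₂_congr fun β hβ => ?_
    have := ih β hβ
    rw [iterDerived] at this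
    rw [this]
    rfl

theorem IsRankFunction.rank_eq {T : TopologicalSpace X} {f : X → Ordinal.{u}}
    (h : IsRankFunction T f) : rank T = f := by
  funext x
  have : {α | x ∉ iterDerived T Set.univ (α + 1)} = Set.Ici (f x) := by
    ext α
    rw [Set.mem_ofPred_eq, h.iterDerived_univ, Set.mem_ofPred_eq, Order.add_one_le_iff, not_lt,
      Set.mem_Ici]
  rw [rank, this, csInf_Ici]

/-- With descent already known, equality with the rank gives the attained values. This is how rank
functions pass to rank-preserving refinements, where openness of `f` is not inherited. -/
theorem isRankFunction_of_rank_eq {T : TopologicalSpace X} {f : X → Ordinal.{u}}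
    (h : DecreasesNear T f) (hf : rank T = f) : IsRankFunction T f := by
  refine ⟨h, fun x U hU hxU β hβ => ?_⟩
  have hx : x ∈ iterDerived T Set.univ (β + 1) := by
    rw [← hf] at hβ
    exact not_not.1 (notMem_of_lt_csInf' hβ)
  rw [iterDerived_add_one, mem_derived] at hx
  obtain ⟨z, hzU, hz, -⟩ := hx U hU hxU
  -- A point of least `f` in this set is isolated in the `β`-th derived set, so its rank is at most
  -- `β`.
  obtain ⟨y, ⟨hyU, hy⟩, hmin⟩ := (InvImage.wf f Ordinal.lt_wf).has_min
    (U ∩ iterDerived T Set.univ β) ⟨z, hzU, hz⟩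
  refine ⟨y, hyU, le_antisymm ?_ (mem_iterDerived_univ_le h β y hy)⟩
  rw [← hf]
  refine csInf_le' ?_
  rw [Set.mem_ofPred_eq, iterDerived_add_one, mem_derived]
  intro hd
  obtain ⟨V, hV, hyV, hlt⟩ := h y
  obtain ⟨w, ⟨hwU, hwV⟩, hw, hwy⟩ := hd (U ∩ V) (@IsOpen.inter X T _ _ hU hV) ⟨hyU, hyV⟩
  exact hmin w ⟨hwU, hw⟩ (hlt w hwV hwy)

theorem IsRankFunction.of_refinement {T S : TopologicalSpace X} {f : X → Ordinal.{u}}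
    (h : IsRankFunction T f) (hS : IsRankPreservingRefinement T S) : IsRankFunction S f :=
  isRankFunction_of_rank_eq (h.decreasesNear.mono hS.isOpen_of_isOpen)
    (hS.rank_eq.symm.trans h.rank_eq)

theorem IsRankFunction.isRankPreservingRefinement {T S : TopologicalSpace X}
    {f : X → Ordinal.{u}} (hT : IsRankFunction T f) (hS : IsRankFunction S f) (hST : S ≤ T) :
    IsRankPreservingRefinement T S :=
  ⟨hT.decreasesNear.isScattered, hST, hT.rank_eq.trans hS.rank_eq.symm⟩

theorem isOpen_iff_forall_exists {T : TopologicalSpace X} {U : Set X} :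
    IsOpen[T] U ↔ ∀ x ∈ U, ∃ V ⊆ U, IsOpen[T] V ∧ x ∈ V :=
  @isOpen_iff_forall_mem_open X T U

theorem IsRankFunction.isOpen_setOf_le {T : TopologicalSpace X} {f : X → Ordinal.{u}}
    (h : IsRankFunction T f) (β : Ordinal.{u}) : IsOpen[T] {x | f x ≤ β} := by
  rw [isOpen_iff_forall_exists]
  intro x hx
  obtain ⟨U, hU, hxU, hlt⟩ := h.decreasesNear x
  refine ⟨U, fun y hy => ?_, hU, hxU⟩
  by_cases hyx : y = x
  · rwa [hyx]
  · exact (hlt y hy hyx).le.trans hx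

/-! ### Consequences of limit-maximality -/

/-- The coarsest refinement of `S` in which `insert x V` is a neighborhood of `x`, for an
`S`-open set `V`. -/
@[reducible]
def insertTopology (S : TopologicalSpace X) (V : Set X) (x : X) : TopologicalSpace X where
  IsOpen W := (∀ y ∈ W, y ≠ x → ∃ U ⊆ W, IsOpen[S] U ∧ y ∈ U) ∧
    (x ∈ W → ∃ U, IsOpen[S] U ∧ x ∈ U ∧ U ∩ V ⊆ W)
  isOpen_univ := ⟨fun _ _ _ => ⟨Set.univ, subset_rfl, @isOpen_univ X S, trivial⟩,
    fun _ => ⟨Set.univ, @isOpen_univ X S, trivial, Set.subset_univ _⟩⟩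
  isOpen_inter W W' h h' := by
    refine ⟨fun y hy hyx => ?_, fun hx => ?_⟩
    · obtain ⟨U, hUW, hU, hyU⟩ := h.1 y hy.1 hyx
      obtain ⟨U', hUW', hU', hyU'⟩ := h'.1 y hy.2 hyx
      exact ⟨U ∩ U', Set.inter_subset_inter hUW hUW', @IsOpen.inter X S _ _ hU hU', hyU, hyU'⟩
    · obtain ⟨U, hU, hxU, hUW⟩ := h.2 hx.1
      obtain ⟨U', hU', hxU', hUW'⟩ := h'.2 hx.2
      exact ⟨U ∩ U', @IsOpen.inter X S _ _ hU hU', ⟨hxU, hxU'⟩,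
        fun y hy => ⟨hUW ⟨hy.1.1, hy.2⟩, hUW' ⟨hy.1.2, hy.2⟩⟩⟩
  isOpen_sUnion s hs := by
    refine ⟨fun y hy hyx => ?_, fun hx => ?_⟩
    · obtain ⟨W, hW, hyW⟩ := hy
      obtain ⟨U, hUW, hU, hyU⟩ := (hs W hW).1 y hyW hyx
      exact ⟨U, hUW.trans (Set.subset_sUnion_of_mem hW), hU, hyU⟩
    · obtain ⟨W, hW, hxW⟩ := hx
      obtain ⟨U, hU, hxU, hUW⟩ := (hs W hW).2 hxW
      exact ⟨U, hU, hxU, hUW.trans (Set.subset_sUnion_of_mem hW)⟩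

/-- In a limit-maximal refinement, an open set that meets every neighborhood of a point `x` of
limit rank in points of rank cofinal in the rank of `x` becomes a neighborhood of `x` by adding
`x`. -/
theorem IsLimitMaximalRefinement.isOpen_insert {T S : TopologicalSpace X} {f : X → Ordinal.{u}}
    (h : IsLimitMaximalRefinement T S) (hT : IsRankFunction T f) {x : X}
    (hx : Order.IsSuccLimit (f x)) {V : Set X} (hV : IsOpen[S] V)
    (hcof : ∀ U, IsOpen[S] U → x ∈ U → ∀ α < f x, ∃ y ∈ U ∩ V, α < f y) :
    IsOpen[S] (insert x V) := by
  have hS := hT.of_refinement h.toIsRankPreservingRefinement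
  have hle : insertTopology S V x ≤ S := by
    intro U hU
    exact ⟨fun y hy _ => ⟨U, subset_rfl, hU, hy⟩, fun hxU => ⟨U, hU, hxU, Set.inter_subset_left⟩⟩
  have hR : IsRankFunction (insertTopology S V x) f := by
    refine ⟨hS.decreasesNear.mono hle, fun y W hW hy β hβ => ?_⟩
    by_cases hyx : y = x
    · subst hyx
      obtain ⟨U, hU, hyU, hUW⟩ := hW.2 hy
      -- Cofinality yields one point of `U ∩ V` of rank above `β`; since `U ∩ V` is open in `S`,
      -- rank `β` itself then occurs in it.
      obtain ⟨z, hz, hβz⟩ := hcof U hU hyU β hβ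
      obtain ⟨w, hw, hwβ⟩ := hS.exists_eq z _ (@IsOpen.inter X S _ _ hU hV) hz β hβz
      exact ⟨w, hUW hw, hwβ⟩
    · obtain ⟨U, hUW, hU, hyU⟩ := hW.1 y hy hyx
      obtain ⟨w, hw, hwβ⟩ := hS.exists_eq y U hU hyU β hβ
      exact ⟨w, hUW hw, hwβ⟩
  have hlim : IsLimitRefinement T (insertTopology S V x) := by
    refine ⟨hT.isRankPreservingRefinement hR (hle.trans h.isOpen_of_isOpen), ?_⟩
    intro y hy W hW hyW
    -- Neighborhoods change only at `x`, whose rank is a limit, so points of non-limit rank keep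
    -- their `T`-neighborhoods.
    have hyx : y ≠ x := by
      rintro rfl
      rw [hT.rank_eq] at hy
      exact hy hx
    obtain ⟨U, hUW, hU, hyU⟩ := hW.1 y hyW hyx
    obtain ⟨V', hV', hyV', hVU⟩ := h.exists_subset y hy U hU hyU
    exact ⟨V', hV', hyV', hVU.trans hUW⟩
  rw [← h.maximal _ hlim hle]
  refine ⟨fun y hy hyx => ⟨V, Set.subset_insert _ _, hV, hy.resolve_left hyx⟩, fun _ =>
    ⟨Set.univ, @isOpen_univ X S, trivial, ?_⟩⟩
  exact Set.inter_subset_right.trans (Set.subset_insert _ _)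

/-- Points of large enough rank near a limit point `x` of `A` of limit rank are limit points
of `A`. -/
theorem IsLimitMaximalRefinement.exists_subset_derived {T S : TopologicalSpace X}
    {f : X → Ordinal.{u}} (h : IsLimitMaximalRefinement T S) (hT : IsRankFunction T f) {x : X}
    (hx : Order.IsSuccLimit (f x)) {A : Set X} (hA : x ∈ derived S A) :
    ∃ α < f x, ∃ U, IsOpen[S] U ∧ x ∈ U ∧ ∀ y ∈ U, α < f y → y ∈ derived S A := by
  have hS := hT.of_refinement h.toIsRankPreservingRefinement
  have hV : IsOpen[S] (@closure X S A)ᶜ := (@isClosed_closure X S A).isOpen_compl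
  have hdisj : ∀ y ∈ A, y ∉ (@closure X S A)ᶜ := fun y hy hc => hc (@subset_closure X S A y hy)
  have hno : ¬ IsOpen[S] (insert x (@closure X S A)ᶜ) := by
    intro hop
    obtain ⟨y, hy, hyA, hyx⟩ := mem_derived.1 hA _ hop (Set.mem_insert _ _)
    exact hdisj y hyA (hy.resolve_left hyx)
  have hcof := mt (h.isOpen_insert hT hx hV) hno
  push Not at hcof
  obtain ⟨U, hU, hxU, α, hα, hUα⟩ := hcof
  -- In `U`, points of rank above `α` lie in the closure of `A`. A bound of `α + 1` leaves room for
  -- a point `z` of rank exactly `α + 1` near `y`; points of `A` close to `z` have rank at most `α +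
  -- 1`, hence differ from `y`, even if `y ∈ A`.
  refine ⟨α + 1, hx.add_one_lt hα, U, hU, hxU, fun y hyU hy => mem_derived.2 fun N hN hyN => ?_⟩
  have hUN := @IsOpen.inter X S _ _ hU hN
  obtain ⟨z, hz, hzα⟩ := hS.exists_eq y _ hUN ⟨hyU, hyN⟩ _ hy
  have hzc : z ∈ @closure X S A := by
    by_contra hc
    exact (hUα z ⟨hz.1, hc⟩).not_gt (by rw [hzα]; exact Order.lt_add_one_iff.2 le_rfl)
  obtain ⟨w, ⟨hw, hwα⟩, hwA⟩ := (@mem_closure_iff X S z A).1 hzc _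
    (@IsOpen.inter X S _ _ hUN (hS.isOpen_setOf_le (α + 1))) ⟨hz, hzα.le⟩
  refine ⟨w, hw.2, hwA, ?_⟩
  rintro rfl
  exact hy.not_ge hwα

/-! ### Passing from the rank `f` to the rank `ell ∘ f` -/

/-- The topology in which a neighborhood of a point `x` of limit rank contains all points of large
enough rank in a `T`-neighborhood of `x`. -/
@[reducible]
def tailTopology (T : TopologicalSpace X) (f : X → Ordinal.{u}) : TopologicalSpace X where
  IsOpen W := ∀ x ∈ W, Order.IsSuccLimit (f x) →
    ∃ α < f x, ∃ U, IsOpen[T] U ∧ x ∈ U ∧ ∀ y ∈ U, α < f y → y ∈ W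
  isOpen_univ _ _ h := ⟨0, h.bot_lt, Set.univ, @isOpen_univ X T, trivial, fun _ _ _ => trivial⟩
  isOpen_inter W W' h h' x hx hlim := by
    obtain ⟨α, hα, U, hU, hxU, hUW⟩ := h x hx.1 hlim
    obtain ⟨α', hα', U', hU', hxU', hUW'⟩ := h' x hx.2 hlim
    exact ⟨max α α', max_lt hα hα', U ∩ U', @IsOpen.inter X T _ _ hU hU', ⟨hxU, hxU'⟩,
      fun y hy hlt => ⟨hUW y hy.1 ((le_max_left _ _).trans_lt hlt),
        hUW' y hy.2 ((le_max_right _ _).trans_lt hlt)⟩⟩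
  isOpen_sUnion s hs x hx hlim := by
    obtain ⟨W, hW, hxW⟩ := hx
    obtain ⟨α, hα, U, hU, hxU, hUW⟩ := hs W hW x hxW hlim
    exact ⟨α, hα, U, hU, hxU, fun y hy hlt => ⟨W, hW, hUW y hy hlt⟩⟩

theorem exists_lt_add_opow {α β δ η : Ordinal.{u}} (hα : α < δ + ω ^ η) (hβ : β < η) :
    ∃ γ, α < γ ∧ γ < δ + ω ^ η ∧ ell γ = β := by
  -- Starting from `max α δ` passes `α`, and additive indecomposability of `ω ^ η` keeps the sum
  -- below `δ + ω ^ η`.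
  refine ⟨max α δ + ω ^ β, ?_, ?_, ell_add_opow _ _⟩
  · exact (le_max_left _ _).trans_lt (lt_add_of_pos_right _ (opow_pos _ omega0_pos))
  · have hβη : (ω : Ordinal.{u}) ^ β < ω ^ η := (opow_lt_opow_iff_right one_lt_omega0).2 hβ
    rcases le_total α δ with h | h
    · rw [max_eq_right h]
      gcongr
    · rw [max_eq_left h, ← Ordinal.add_sub_cancel_of_le h, add_assoc]
      rw [← Ordinal.add_sub_cancel_of_le h] at hα
      have := lt_of_add_lt_add_left hα
      gcongr
      exact isPrincipal_add_omega0_opow η this hβη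

theorem isSuccLimit_of_ell_ne_zero {ξ : Ordinal.{u}} (h : ell ξ ≠ 0) : Order.IsSuccLimit ξ := by
  have h0 : ξ ≠ 0 := by
    rintro rfl
    exact h ell_zero
  obtain ⟨β, ⟨α, rfl⟩, -⟩ := existsUnique_lastExponent h0
  rw [ell_add_opow] at h
  exact isSuccLimit_add _ (isSuccLimit_opow_left isSuccLimit_omega0 h)

/-- If `ξ = α + ω ^ β`, an ordinal strictly between `α` and `ξ` is `α + ε` with `0 < ε < ω ^ β`, and
the last exponent of `ε` is below `β`. -/
theorem exists_forall_ell_lt {ξ : Ordinal.{u}} (h : ξ ≠ 0) :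
    ∃ α < ξ, ∀ γ, α < γ → γ < ξ → ell γ < ell ξ := by
  obtain ⟨β, ⟨α, rfl⟩, -⟩ := existsUnique_lastExponent h
  refine ⟨α, lt_add_of_pos_right _ (opow_pos _ omega0_pos), fun γ hαγ hγ => ?_⟩
  obtain ⟨ε, rfl⟩ : ∃ ε, γ = α + ε := ⟨_, (Ordinal.add_sub_cancel_of_le hαγ.le).symm⟩
  have h0 : ε ≠ 0 := ((lt_add_iff_pos_right α).1 hαγ).ne'
  have hlt := lt_of_add_lt_add_left hγ
  obtain ⟨β', ⟨α', rfl⟩, -⟩ := existsUnique_lastExponent h0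
  rw [← add_assoc, ell_add_opow, ell_add_opow]
  exact (opow_lt_opow_iff_right one_lt_omega0).1 (le_add_self.trans_lt hlt)

theorem IsRankFunction.ell_comp {T S : TopologicalSpace X} {f : X → Ordinal.{u}}
    (hT : IsRankFunction T f) (hS : DecreasesNear S (ell ∘ f)) (hle : tailTopology T f ≤ S) :
    IsRankFunction S (ell ∘ f) := by
  refine ⟨hS, fun x W hW hx β hβ => ?_⟩
  rw [Function.comp_apply] at hβ
  have hlim : Order.IsSuccLimit (f x) := isSuccLimit_of_ell_ne_zero (pos_of_gt hβ).ne'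
  obtain ⟨α, hα, U, hU, hxU, hUW⟩ := hle W hW x hx hlim
  obtain ⟨η, ⟨δ, hδ⟩, -⟩ := existsUnique_lastExponent hlim.ne_bot
  rw [hδ] at hα hβ
  rw [ell_add_opow] at hβ
  obtain ⟨γ, hαγ, hγ, rfl⟩ := exists_lt_add_opow hα hβ
  rw [← hδ] at hγ
  obtain ⟨y, hy, rfl⟩ := hT.exists_eq x U hU hxU γ hγ
  exact ⟨y, hUW y hy hαγ, rfl⟩

/-- Descent of `f` bounds nearby values above by `f x`, and `hlt` bounds them below; together they
trap the values in an interval where `ell` is smaller than at `f x`. -/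
theorem DecreasesNear.ell_comp {T S : TopologicalSpace X} {f : X → Ordinal.{u}}
    (hT : DecreasesNear T f) (hST : S ≤ T)
    (hlt : ∀ x, ∀ α < f x, ∃ U, IsOpen[S] U ∧ x ∈ U ∧ ∀ y ∈ U, α < f y) :
    DecreasesNear S (ell ∘ f) := by
  intro x
  obtain ⟨U, hU, hxU, hUx⟩ := hT x
  by_cases h0 : f x = 0
  · refine ⟨U, hST U hU, hxU, fun y hy hyx => ?_⟩
    exact absurd (hUx y hy hyx) (by rw [h0]; exact zero_le.not_gt)
  · obtain ⟨α, hα, hell⟩ := exists_forall_ell_lt h0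
    obtain ⟨V, hV, hxV, hVα⟩ := hlt x α hα
    exact ⟨U ∩ V, @IsOpen.inter X S _ _ (hST U hU) hV, ⟨hxU, hxV⟩, fun y hy hyx =>
      hell _ (hVα y hy.2) (hUx y hy.1 hyx)⟩

theorem plusTopology_le (T : TopologicalSpace X) : plusTopology T ≤ T := fun _ hU =>
  TopologicalSpace.isOpen_generateFrom_of_mem (Or.inl hU)

theorem isOpen_plusTopology_derived (T : TopologicalSpace X) (A : Set X) :
    IsOpen[plusTopology T] (derived T A) :=
  TopologicalSpace.isOpen_generateFrom_of_mem (Or.inr ⟨A, rfl⟩)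

theorem IsRankFunction.isOpen_plusTopology {T : TopologicalSpace X} {f : X → Ordinal.{u}}
    (h : IsRankFunction T f) (α : Ordinal.{u}) : IsOpen[plusTopology T] {x | α < f x} := by
  have hd : {x | α < f x} = derived T {y | α ≤ f y} :=
    Set.ext fun x => (h.mem_derived_iff α x).symm
  rw [hd]
  exact isOpen_plusTopology_derived T _

theorem IsLimitMaximalRefinement.isRankFunction_plusTopology {T S : TopologicalSpace X}
    {f : X → Ordinal.{u}} (h : IsLimitMaximalRefinement T S) (hT : IsRankFunction T f) :
    IsRankFunction (plusTopology S) (ell ∘ f) := by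
  have hS := hT.of_refinement h.toIsRankPreservingRefinement
  refine hS.ell_comp (hS.decreasesNear.ell_comp (plusTopology_le S) fun x α hα =>
    ⟨_, hS.isOpen_plusTopology α, hα, fun _ hy => hy⟩) (le_generateFrom ?_)
  rintro W (hW | ⟨A, rfl⟩) x hx hlim
  · exact ⟨0, hlim.bot_lt, W, hW, hx, fun y hy _ => hy⟩
  · exact h.exists_subset_derived hT hlim hx

end Topology

/-! ### Hyperlogarithms at limit exponents -/

theorem isHyperlogarithm_hyperlog : IsHyperlogarithm hyperlog.{u} :=
  existsUnique_isHyperlogarithm.choose_spec.1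

theorem hyperlog_eq_hyperlogAux : hyperlog.{u} = hyperlogAux :=
  existsUnique_isHyperlogarithm.unique isHyperlogarithm_hyperlog isHyperlogarithm_hyperlogAux

theorem hyperlog_zero : hyperlog (0 : Ordinal.{u}) = id := by
  rw [hyperlog_eq_hyperlogAux, hyperlogAux_zero]

theorem hyperlog_one : hyperlog (1 : Ordinal.{u}) = ell :=
  isHyperlogarithm_hyperlog.one

theorem hyperlog_add (α β x : Ordinal.{u}) :
    hyperlog (α + β) x = hyperlog β (hyperlog α x) :=
  congrFun (isHyperlogarithm_hyperlog.add α β) x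

theorem hyperlog_add_one (α : Ordinal.{u}) : hyperlog (α + 1) = ell ∘ hyperlog α := by
  rw [isHyperlogarithm_hyperlog.add, hyperlog_one]

theorem hyperlog_le_self (ξ x : Ordinal.{u}) : hyperlog ξ x ≤ x :=
  (isHyperlogarithm_hyperlog.isInitial ξ).le_self x

/-- The hyperlogarithm at a power of `ω` is computed by `limStep`. -/
theorem hyperlog_omega0_opow {δ : Ordinal.{u}} (hδ : δ ≠ 0) :
    hyperlog (ω ^ δ) = limStep fun x => ⨅ η : Set.Iio (ω ^ δ), hyperlog η.1 x := by
  have h1 : (1 : Ordinal.{u}) < ω ^ δ := one_lt_opow.2 ⟨one_lt_omega0, hδ⟩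
  rw [hyperlog_eq_hyperlogAux]
  refine hyperlogAux_of_not_lt (pos_of_gt h1).ne' h1.ne' ?_
  rw [log_opow one_lt_omega0]
  exact lt_irrefl _

/-- At a limit `ξ`, the values of the hyperlogarithm at `x` and at `y` compare strictly as soon as
the values of an earlier hyperlogarithm do. -/
theorem exists_hyperlog_lt_of_isSuccLimit {ξ : Ordinal.{u}} (hξ : Order.IsSuccLimit ξ)
    (x : Ordinal.{u}) :
    ∃ ζ < ξ, ∀ y, hyperlog ζ y < hyperlog ζ x → hyperlog ξ y < hyperlog ξ x := by
  obtain ⟨δ, ⟨α, rfl⟩, -⟩ := existsUnique_lastExponent hξ.ne_bot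
  have hδ : δ ≠ 0 := by
    rintro rfl
    rw [opow_zero] at hξ
    exact lt_irrefl _ (hξ.add_one_lt (lt_add_one α))
  have hP : IsPrincipal (· + ·) (ω ^ δ : Ordinal.{u}) := isPrincipal_add_omega0_opow δ
  have hstep := hyperlog_omega0_opow hδ
  have hpos : (0 : Ordinal.{u}) < ω ^ δ := opow_pos _ omega0_pos
  generalize (ω : Ordinal.{u}) ^ δ = p at *
  have : Nonempty (Set.Iio p) := ⟨⟨0, hpos⟩⟩
  -- After `ζ` the value has reached its minimum over all exponents below `p`, so it is fixed by the
  -- function iterated in `limStep`. There `limStep` is a supremum of successors and exceeds all its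
  -- values at smaller arguments.
  obtain ⟨⟨ζ, hζ⟩, hmin⟩ := ciInf_mem fun η : Set.Iio p => hyperlog η.1 (hyperlog α x)
  have hvle : ∀ x, ⨅ η : Set.Iio p, hyperlog η.1 x ≤ x := fun x =>
    (ciInf_le' _ ⟨0, hpos⟩).trans (hyperlog_le_self 0 x)
  have hfix := iInf_comp hyperlog_le_self hP
    (fun a b _ => isHyperlogarithm_hyperlog.add a b) hζ (hyperlog α x)
  refine ⟨α + ζ, add_lt_add_right hζ α, fun y hy => ?_⟩
  rw [hyperlog_add, hyperlog_add] at hy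
  -- Since `ζ + p = p`, applying `ℓ^ζ` before `ℓ^p` changes nothing.
  rw [hyperlog_add, hyperlog_add, ← hP.add_eq_right hζ, hyperlog_add, hyperlog_add, hstep,
    limStep_of_not_lt (x := hyperlog ζ (hyperlog α x)) (by rw [hfix]; exact hmin.le.not_gt)]
  exact Order.add_one_le_iff.1 (Ordinal.le_iSup
    (fun z : Set.Iio (hyperlog ζ (hyperlog α x)) => limStep _ z.1 + 1) ⟨_, hy⟩)

/-! ### Icard topologies and the interval topology -/

section Icard

variable {Θ : Ordinal.{u}}

theorem hyperlog_coe_lt (ζ : Ordinal.{u}) (x : Θ.ToType) : hyperlog ζ (x : Ordinal.{u}) < Θ :=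
  (hyperlog_le_self ζ _).trans_lt (ToType.toOrd x).2

theorem icardTopology_of_ne_zero {ξ : Ordinal.{u}} (h : ξ ≠ 0) :
    icardTopology Θ ξ = TopologicalSpace.generateFrom
      ({U | ∃ ζ < ξ, ∃ β ≤ Θ, U = {x : Θ.ToType | hyperlog ζ x ≤ β}} ∪
        {U | ∃ ζ < ξ, ∃ α β, α < β ∧ β ≤ Θ ∧
          U = {x : Θ.ToType | α < hyperlog ζ x ∧ hyperlog ζ x ≤ β}}) :=
  if_neg h

theorem isOpen_icardTopology_hyperlog_le {ζ ξ : Ordinal.{u}} (h : ζ < ξ) {β : Ordinal.{u}}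
    (hβ : β ≤ Θ) : IsOpen[icardTopology Θ ξ] {x : Θ.ToType | hyperlog ζ x ≤ β} := by
  rw [icardTopology_of_ne_zero (pos_of_gt h).ne']
  exact TopologicalSpace.isOpen_generateFrom_of_mem (Or.inl ⟨ζ, h, β, hβ, rfl⟩)

theorem isOpen_icardTopology_lt_hyperlog {ζ ξ : Ordinal.{u}} (h : ζ < ξ) {α : Ordinal.{u}}
    (hα : α < Θ) : IsOpen[icardTopology Θ ξ] {x : Θ.ToType | α < hyperlog ζ x} := by
  have hset : {x : Θ.ToType | α < hyperlog ζ x} =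
      {x : Θ.ToType | α < hyperlog ζ x ∧ hyperlog ζ x ≤ Θ} :=
    Set.ext fun x => (and_iff_left (hyperlog_coe_lt ζ x).le).symm
  rw [icardTopology_of_ne_zero (pos_of_gt h).ne', hset]
  exact TopologicalSpace.isOpen_generateFrom_of_mem (Or.inr ⟨ζ, h, α, Θ, hα, le_rfl, rfl⟩)

theorem le_icardTopology {S : TopologicalSpace Θ.ToType} {ξ : Ordinal.{u}} (hξ : ξ ≠ 0)
    (hle : ∀ ζ < ξ, ∀ β ≤ Θ, IsOpen[S] {x : Θ.ToType | hyperlog ζ x ≤ β})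
    (hlt : ∀ ζ < ξ, ∀ α < Θ, IsOpen[S] {x : Θ.ToType | α < hyperlog ζ x}) :
    S ≤ icardTopology Θ ξ := by
  rw [icardTopology_of_ne_zero hξ]
  refine le_generateFrom ?_
  rintro U (⟨ζ, hζ, β, hβ, rfl⟩ | ⟨ζ, hζ, α, β, hαβ, hβ, rfl⟩)
  · exact hle ζ hζ β hβ
  · exact @IsOpen.inter _ S _ _ (hlt ζ hζ α (hαβ.trans_le hβ)) (hle ζ hζ β hβ)

theorem icardTopology_anti {ζ ξ : Ordinal.{u}} (h : ζ ≤ ξ) :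
    icardTopology Θ ξ ≤ icardTopology Θ ζ := by
  rcases h.eq_or_lt with rfl | h
  · exact le_rfl
  by_cases h0 : ζ = 0
  · subst h0
    intro U hU
    rw [icardTopology, if_pos rfl] at hU
    rw [isOpen_iff_forall_exists]
    refine fun x hx => ⟨_, fun y hy => ?_,
      isOpen_icardTopology_hyperlog_le h (hyperlog_coe_lt 0 x).le, le_refl (hyperlog 0 x.toOrd.1)⟩
    rw [Set.mem_ofPred_eq, hyperlog_zero] at hy
    exact hU (ToType.mk.symm.le_iff_le.1 hy) hx
  · exact le_icardTopology h0
      (fun η hη β hβ => isOpen_icardTopology_hyperlog_le (hη.trans h) hβ)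
      (fun η hη α hα => isOpen_icardTopology_lt_hyperlog (hη.trans h) hα)

theorem toOrd_le_toOrd {x y : Θ.ToType} (h : x ≤ y) : (x : Ordinal.{u}) ≤ y :=
  ToType.mk.symm.monotone h

theorem isRankFunction_initialSegmentTopology :
    IsRankFunction (initialSegmentTopology Θ) fun x => (x : Ordinal.{u}) := by
  refine ⟨fun x => ⟨Set.Iic x, isLowerSet_Iic x, Set.self_mem_Iic, fun y hy hyx => ?_⟩,
    fun x U hU hx β hβ => ⟨ToType.mk ⟨β, hβ.trans (ToType.toOrd x).2⟩, hU ?_ hx, ?_⟩⟩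
  · exact ToType.mk.symm.lt_iff_lt.2 (lt_of_le_of_ne hy hyx)
  · rw [← ToType.mk.symm.le_iff_le, OrderIso.symm_apply_apply]
    exact hβ.le
  · rw [ToType.toOrd, OrderIso.symm_apply_apply]

/-- The function `ℓ^ξ` decreases strictly near every point of the Icard topology `I_ξ`. -/
theorem decreasesNear_icardTopology (ξ : Ordinal.{u}) :
    DecreasesNear (icardTopology Θ ξ) fun x => hyperlog ξ (x : Ordinal.{u}) := by
  induction ξ using Ordinal.limitRecOn with
  | zero =>
    rw [icardTopology, if_pos rfl, hyperlog_zero]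
    exact isRankFunction_initialSegmentTopology.decreasesNear
  | add_one ξ ih =>
    rw [hyperlog_add_one]
    exact ih.ell_comp (icardTopology_anti le_self_add) fun x α hα =>
      ⟨_, isOpen_icardTopology_lt_hyperlog (lt_add_one ξ) (hα.trans (hyperlog_coe_lt ξ x)), hα,
        fun _ hy => hy⟩
  | limit ξ hξ ih =>
    intro x
    obtain ⟨ζ, hζ, hlt⟩ := exists_hyperlog_lt_of_isSuccLimit hξ (x : Ordinal.{u})
    obtain ⟨U, hU, hxU, hUx⟩ := ih ζ hζ x
    exact ⟨U, icardTopology_anti hζ.le U hU, hxU, fun y hy hyx => hlt _ (hUx y hy hyx)⟩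

theorem intervalTopology_le_icardTopology : intervalTopology Θ ≤ icardTopology Θ 1 := by
  refine le_icardTopology one_ne_zero (fun ζ hζ β _ => ?_) fun ζ hζ α _ => ?_
  · rw [Order.lt_one_iff.1 hζ, hyperlog_zero]
    exact TopologicalSpace.isOpen_generateFrom_of_mem (Or.inl ⟨β, rfl⟩)
  · have hset : {x : Θ.ToType | α < hyperlog ζ x} =
        {x : Θ.ToType | α < (x : Ordinal.{u}) ∧ (x : Ordinal.{u}) ≤ Θ} := by
      rw [Order.lt_one_iff.1 hζ, hyperlog_zero]
      exact Set.ext fun x => (and_iff_left (ToType.toOrd x).2.le).symm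
    rw [hset]
    exact TopologicalSpace.isOpen_generateFrom_of_mem (Or.inr ⟨α, Θ, rfl⟩)

/-- The interval topology stands to the initial segment topology, whose rank is the identity, as a
plus topology to its base: its open sets contain tails near limit points. -/
theorem isRankFunction_intervalTopology :
    IsRankFunction (intervalTopology Θ) fun x => hyperlog 1 (x : Ordinal.{u}) := by
  have hd := (decreasesNear_icardTopology (Θ := Θ) 1).mono intervalTopology_le_icardTopology
  rw [hyperlog_one] at hd ⊢
  refine isRankFunction_initialSegmentTopology.ell_comp hd (le_generateFrom ?_)
  rintro W (⟨β, rfl⟩ | ⟨α, β, rfl⟩) x hx hlim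
  · exact ⟨0, hlim.bot_lt, Set.Iic x, isLowerSet_Iic x, Set.self_mem_Iic,
      fun y hy _ => (toOrd_le_toOrd hy).trans hx⟩
  · exact ⟨α, hx.1, Set.Iic x, isLowerSet_Iic x, Set.self_mem_Iic,
      fun y hy hαy => ⟨hαy, (toOrd_le_toOrd hy).trans hx.2⟩⟩

end Icard

/-! ### Induction along a BG space -/

section BGSpace

variable {Θ Λ : Ordinal.{u}} {T : Ordinal.{u} → TopologicalSpace Θ.ToType}

theorem joinTopology_le {X : Type u} (T : Ordinal.{u} → TopologicalSpace X) {ζ ξ : Ordinal.{u}}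
    (h : ζ < ξ) : joinTopology T ξ ≤ T ζ := fun _ hU =>
  TopologicalSpace.isOpen_generateFrom_of_mem ⟨ζ, h, hU⟩

theorem IsBGSpace.anti (hT : IsBGSpace Θ Λ T) {ζ ξ : Ordinal.{u}} (hζ : ζ ≤ ξ) (hξ : ξ < Λ) :
    T ξ ≤ T ζ := by
  induction ξ using Ordinal.limitRecOn with
  | zero => rw [nonpos_iff_eq_zero.1 hζ]
  | add_one ξ ih =>
    rcases hζ.eq_or_lt with rfl | h
    · exact le_rfl
    have h1 : T (ξ + 1) ≤ plusTopology (T ξ) := (hT.add_one ξ hξ).isOpen_of_isOpen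
    exact (h1.trans (plusTopology_le _)).trans
      (ih (Order.lt_add_one_iff.1 h) ((lt_add_one ξ).trans hξ))
  | limit ξ hlim _ =>
    rcases hζ.eq_or_lt with rfl | h
    · exact le_rfl
    have h1 : T ξ ≤ joinTopology T ξ := (hT.limit ξ hξ hlim).isOpen_of_isOpen
    exact h1.trans (joinTopology_le T h)

/-- The join of an increasing family of topologies at a limit has the union as a base. -/
theorem exists_isOpen_of_isOpen_joinTopology {X : Type u} {T : Ordinal.{u} → TopologicalSpace X}
    {ξ : Ordinal.{u}} (hξ : 0 < ξ) (hT : ∀ η < ξ, ∀ ζ ≤ η, T η ≤ T ζ) {W : Set X}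
    (hW : IsOpen[joinTopology T ξ] W) {x : X} (hx : x ∈ W) :
    ∃ ζ < ξ, ∃ U ⊆ W, IsOpen[T ζ] U ∧ x ∈ U := by
  induction hW with
  | basic W hW =>
    obtain ⟨ζ, hζ, hW⟩ := hW
    exact ⟨ζ, hζ, W, subset_rfl, hW, hx⟩
  | univ => exact ⟨0, hξ, Set.univ, subset_rfl, @isOpen_univ _ (T 0), trivial⟩
  | inter W W' _ _ ih ih' =>
    obtain ⟨ζ, hζ, U, hUW, hU, hxU⟩ := ih hx.1
    obtain ⟨ζ', hζ', U', hUW', hU', hxU'⟩ := ih' hx.2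
    have hmax := max_lt hζ hζ'
    exact ⟨max ζ ζ', hmax, U ∩ U', Set.inter_subset_inter hUW hUW',
      @IsOpen.inter _ (T _) _ _ (hT _ hmax _ (le_max_left _ _) U hU)
        (hT _ hmax _ (le_max_right _ _) U' hU'), hxU, hxU'⟩
  | sUnion s _ ih =>
    obtain ⟨W, hWs, hxW⟩ := hx
    obtain ⟨ζ, hζ, U, hUW, hU, hxU⟩ := ih W hWs hxW
    exact ⟨ζ, hζ, U, hUW.trans (Set.subset_sUnion_of_mem hWs), hU, hxU⟩

theorem IsBGSpace.isRankFunction_joinTopology (hT : IsBGSpace Θ Λ T) {ξ : Ordinal.{u}}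
    (hξ : ξ < Λ) (hlim : Order.IsSuccLimit ξ)
    (hrank : ∀ ζ < ξ, IsRankFunction (T ζ) fun x => hyperlog (1 + ζ) (x : Ordinal.{u}))
    (hle : joinTopology T ξ ≤ icardTopology Θ (1 + ξ)) :
    IsRankFunction (joinTopology T ξ) fun x => hyperlog (1 + ξ) (x : Ordinal.{u}) := by
  refine ⟨(decreasesNear_icardTopology _).mono hle, fun x W hW hx β hβ => ?_⟩
  obtain ⟨ζ, hζ, U, hUW, hU, hxU⟩ := exists_isOpen_of_isOpen_joinTopology hlim.bot_lt
    (fun η hη ζ hζ => hT.anti hζ (hη.trans hξ)) hW hx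
  have hcomp : ∀ z, hyperlog (1 + ξ) z = hyperlog (ξ - ζ) (hyperlog (1 + ζ) z) := fun z => by
    rw [← hyperlog_add, add_assoc, Ordinal.add_sub_cancel_of_le hζ.le]
  simp only [hcomp] at hβ ⊢
  -- Initiality of `ℓ^(ξ-ζ)` pulls the value `β` back to some `ν` below the rank of `x` in `T ζ`,
  -- where it is attained.
  obtain ⟨ν, hν, rfl⟩ := isInitialFunction_iff.1 (isHyperlogarithm_hyperlog.isInitial (ξ - ζ)) _ _
    hβ.le
  obtain ⟨y, hy, hyν⟩ := (hrank ζ hζ).exists_eq x U hU hxU ν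
    (lt_of_le_of_ne hν fun h => hβ.ne (by rw [h]))
  exact ⟨y, hUW hy, by rw [hyν]⟩

/-- Every topology of a Beklemishev-Gabelaia space is a limit-maximal refinement of a topology
finer than the Icard topology and having the same ranks. -/
theorem IsBGSpace.exists_isLimitMaximalRefinement (hT : IsBGSpace Θ Λ T) {ξ : Ordinal.{u}}
    (hξ : ξ < Λ) :
    ∃ S, IsLimitMaximalRefinement S (T ξ) ∧
      IsRankFunction S (fun x => hyperlog (1 + ξ) (x : Ordinal.{u})) ∧
        S ≤ icardTopology Θ (1 + ξ) := by
  induction ξ using Ordinal.limitRecOn with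
  | zero =>
    rw [add_zero]
    exact ⟨_, hT.zero hξ, isRankFunction_intervalTopology, intervalTopology_le_icardTopology⟩
  | add_one ξ ih =>
    obtain ⟨S, hS, hrank, hle⟩ := ih ((lt_add_one ξ).trans hξ)
    have hrank' := hrank.of_refinement hS.toIsRankPreservingRefinement
    have hle' : T ξ ≤ icardTopology Θ (1 + ξ) :=
      (le_iff_forall_isOpen.2 hS.isOpen_of_isOpen).trans hle
    refine ⟨_, hT.add_one ξ hξ, ?_, ?_⟩
    · rw [← add_assoc, hyperlog_add_one]
      exact hS.isRankFunction_plusTopology hrank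
    · rw [← add_assoc]
      refine le_icardTopology (add_pos_of_nonneg_of_pos zero_le one_pos).ne' (fun ζ hζ β hβ => ?_)
        fun ζ hζ α hα => ?_
      -- The only new exponent is `1 + ξ`, whose hyperlogarithm is the rank of `T ξ`; its lower and
      -- upper level sets are open in the plus topology.
      · rcases (Order.lt_add_one_iff.1 hζ).lt_or_eq with h | rfl
        · exact plusTopology_le _ _ (hle' _ (isOpen_icardTopology_hyperlog_le h hβ))
        · exact plusTopology_le _ _ (hrank'.isOpen_setOf_le β)
      · rcases (Order.lt_add_one_iff.1 hζ).lt_or_eq with h | rfl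
        · exact plusTopology_le _ _ (hle' _ (isOpen_icardTopology_lt_hyperlog h hα))
        · exact hrank'.isOpen_plusTopology α
  | limit ξ hlim ih =>
    have hrank : ∀ ζ < ξ, IsRankFunction (T ζ) fun x => hyperlog (1 + ζ) (x : Ordinal.{u}) := by
      intro ζ hζ
      obtain ⟨S, hS, hSr, -⟩ := ih ζ hζ (hζ.trans hξ)
      exact hSr.of_refinement hS.toIsRankPreservingRefinement
    have hjoin : ∀ ζ < ξ, joinTopology T ξ ≤ icardTopology Θ (1 + ζ) := by
      intro ζ hζ
      obtain ⟨S, hS, -, hSle⟩ := ih ζ hζ (hζ.trans hξ)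
      exact ((joinTopology_le T hζ).trans (le_iff_forall_isOpen.2 hS.isOpen_of_isOpen)).trans hSle
    have hle : joinTopology T ξ ≤ icardTopology Θ (1 + ξ) := by
      have hlt : ∀ {ζ}, ζ < 1 + ξ → ∃ η < ξ, ζ < 1 + η := by
        intro ζ hζ
        -- For a limit `ξ`, `1 + ξ = ξ`, so each exponent already occurs at an earlier stage.
        rw [one_add_of_omega0_le (omega0_le_of_isSuccLimit hlim)] at hζ
        exact ⟨ζ + 1, hlim.add_one_lt hζ, (lt_add_one ζ).trans_le le_add_self⟩
      refine le_icardTopology (add_pos_of_pos_of_nonneg one_pos zero_le).ne' (fun ζ hζ β hβ => ?_)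
        fun ζ hζ α hα => ?_
      · obtain ⟨η, hη, hζη⟩ := hlt hζ
        exact hjoin η hη _ (isOpen_icardTopology_hyperlog_le hζη hβ)
      · obtain ⟨η, hη, hζη⟩ := hlt hζ
        exact hjoin η hη _ (isOpen_icardTopology_lt_hyperlog hζη hα)
    exact ⟨_, hT.limit ξ hξ hlim, hT.isRankFunction_joinTopology hξ hlim hrank hle, hle⟩

end BGSpace

end GLPSpace

theorem mainTheorem8 (Θ Λ : Ordinal.{u}) (T : Ordinal.{u} → TopologicalSpace Θ.ToType)
    (hT : GLPSpace.IsBGSpace Θ Λ T) :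
    ∀ ξ < Λ,
      GLPSpace.IsRankPreservingRefinement (GLPSpace.icardTopology Θ (1 + ξ)) (T ξ) ∧
        ∀ x : Θ.ToType, GLPSpace.rank (T ξ) x = GLPSpace.hyperlog (1 + ξ) (x : Ordinal.{u}) := by
  intro ξ hξ
  obtain ⟨S, hS, hSrank, hle⟩ := hT.exists_isLimitMaximalRefinement hξ
  have hrank := hSrank.of_refinement hS.toIsRankPreservingRefinement
  have hle' : T ξ ≤ GLPSpace.icardTopology Θ (1 + ξ) :=
    (GLPSpace.le_iff_forall_isOpen.2 hS.isOpen_of_isOpen).trans hle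
  -- The Icard topology inherits the attained values from the finer `T ξ`, so only its descent is
  -- proved directly.
  exact ⟨(hrank.of_le (GLPSpace.decreasesNear_icardTopology _) hle').isRankPreservingRefinement
    hrank hle', fun x => congrFun hrank.rank_eq x⟩
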